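/- Let $S^3\subset\mathbb R^4$ be the unit sphere with coordinates $z^1,z^2,z^3,z^4$, let $M=\mathbb R\times S^3$, and let $x^0$ be the coordinate on $\mathbb R$. Let $x=(x^1,x^2,x^3)$ be the north pole stereographic coordinates on $S^3$, given by $z^i=\frac{2x^i}{|x|^2+1}$ $(i=1,2,3)$, $z^4=\frac{|x|^2-1}{|x|^2+1}$. Let $R=R(x^0)>0$ and equip $M$ with the metric $$ds^2=R^2\,(dx^0)^2-\frac{4R^2\left((dx^1)^2+(dx^2)^2+(dx^3)^2\right)}{(|x|^2+1)^2},$$ which has the same form in the south pole stereographic coordinates $y=x/|x|^2$, that is, $ds^2=R^2\big((dx^0)^2-d\sigma^2\big)$ with $d\sigma^2$ the round metric of the unit sphere. A Killing field is a smooth vector field $X$ on $M$ with $L_Xg=0$. Let $X_1,\dots,X_6$ be the vector fields on $M$ produced by the rotations of $S^3$ in the planes $z^1Oz^4$, $z^2Oz^4$, $z^3Oz^4$, $z^1Oz^2$, $z^2Oz^3$, $z^3Oz^1$; in north pole stereographic coordinates, with $\partial_i=\partial/\partial x^i$, $$X_j=\tfrac{1-|x|^2}{2}\,\partial_j+x^j\sum_{i=1}^3x^i\partial_i\quad(j=1,2,3),$$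 $$X_4=x^2\partial_1-x^1\partial_2,\qquad X_5=x^3\partial_2-x^2\partial_3,\qquad X_6=x^1\partial_3-x^3\partial_1.$$ Theorem 6.1. Suppose that $R'=0$, i.e. that $R$ is a positive constant. Then $X_1,\dots,X_6$ are linearly independent Killing fields and are space-like ($g(X_k,X_k)<0$ wherever $X_k\neq0$); the field $\partial/\partial x^0$ is a time-like Killing field ($g(\partial/\partial x^0,\partial/\partial x^0)>0$ everywhere) which is not a linear combination of $X_1,\dots,X_6$ with constant coefficients; and $X_1,\dots,X_6,\partial/\partial x^0$ span the real vector space of all Killing fields of $M$, which therefore has dimension $7$. -/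

import Mathlib

open scoped Manifold ContDiff

noncomputable section

namespace ClosedUniverse

/-- The Euclidean space `ℝ⁴` with coordinates `z¹, z², z³, z⁴` (indices `0, 1, 2, 3`). -/
abbrev E4 : Type := EuclideanSpace ℝ (Fin 4)

/-- The Euclidean space `ℝ³` in which the stereographic coordinates take their values. -/
abbrev E3 : Type := EuclideanSpace ℝ (Fin 3)

/-- The unit sphere `S³` in `ℝ⁴`, with Mathlib's smooth structure. -/
abbrev S3 : Type := Metric.sphere (0 : E4) 1

/-- The universe `M = ℝ × S³`; the first component of a point is `x⁰`. -/
abbrev Universe : Type := ℝ × S3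

/-- The model with corners of the smooth manifold `M = ℝ × S³`. -/
abbrev modelM : ModelWithCorners ℝ (ℝ × E3) (ModelProd ℝ E3) := 𝓘(ℝ, ℝ).prod (𝓡 3)

/-- Vector fields on `M`, not necessarily smooth. -/
abbrev VectorField : Type := (p : Universe) → TangentSpace modelM p

/-- A vector field of class `C^∞`. -/
def IsSmooth (X : VectorField) : Prop :=
  ContMDiff modelM modelM.tangent ∞
    (fun p : Universe => (⟨p, X p⟩ : TangentBundle modelM Universe))

/-- The differential at `z` of the inclusion `S³ ⊂ ℝ⁴`. -/
def sphereIncl (z : S3) : TangentSpace (𝓡 3) z →L[ℝ] E4 :=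
  mvfderiv (𝓡 3) ((↑) : S3 → E4) z

/-- The metric of the closed universe whose sphere has radius `R(x⁰)`:
`ds² = R(x⁰)² ((dx⁰)² - dσ²)`, where `dσ²` is the round metric which the unit sphere `S³` inherits
from `ℝ⁴`.  Its expression in the two stereographic charts is computed in `metric_north` and
`metric_south` below. -/
def metric (R : ℝ → ℝ) (p : Universe) (u v : TangentSpace modelM p) : ℝ :=
  R p.1 ^ 2 * (u.1 * v.1 - inner ℝ (sphereIncl p.2 u.2) (sphereIncl p.2 v.2))

/-- The Lie derivative of the metric,
`(L_X g)(Y, Z) = X (g (Y, Z)) - g ([X, Y], Z) - g (Y, [X, Z])`. -/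
def lieDerivMetric (R : ℝ → ℝ) (X Y Z : VectorField) (p : Universe) : ℝ :=
  mvfderiv modelM (fun q : Universe => metric R q (Y q) (Z q)) p (X p)
    - metric R p (VectorField.mlieBracket modelM X Y p) (Z p)
    - metric R p (Y p) (VectorField.mlieBracket modelM X Z p)

/-- A Killing field is a smooth vector field `X` with `L_X g = 0`. -/
def IsKilling (R : ℝ → ℝ) (X : VectorField) : Prop :=
  IsSmooth X ∧ ∀ Y Z : VectorField, IsSmooth Y → IsSmooth Z →
    ∀ p : Universe, lieDerivMetric R X Y Z p = 0

lemma IsSmooth.mdifferentiableAt {X : VectorField} (hX : IsSmooth X) (p : Universe) :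
    MDifferentiableAt modelM modelM.tangent
      (fun q : Universe => (⟨q, X q⟩ : TangentBundle modelM Universe)) p :=
  (hX p).mdifferentiableAt (by simp)

lemma metric_add_left (R : ℝ → ℝ) (p : Universe) (u u' v : TangentSpace modelM p) :
    metric R p (u + u') v = metric R p u v + metric R p u' v := by
  have h1 : (u + u').1 = u.1 + u'.1 := rfl
  have h2 : sphereIncl p.2 (u + u').2 = sphereIncl p.2 u.2 + sphereIncl p.2 u'.2 :=
    map_add (sphereIncl p.2) u.2 u'.2
  simp only [metric, h1, h2, inner_add_left]
  ring

lemma metric_smul_left (R : ℝ → ℝ) (p : Universe) (c : ℝ) (u v : TangentSpace modelM p) :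
    metric R p (c • u) v = c * metric R p u v := by
  have h1 : (c • u).1 = c * u.1 := rfl
  have h2 : sphereIncl p.2 (c • u).2 = c • sphereIncl p.2 u.2 :=
    map_smul (sphereIncl p.2) c u.2
  simp only [metric, h1, h2, real_inner_smul_left]
  ring

lemma metric_comm (R : ℝ → ℝ) (p : Universe) (u v : TangentSpace modelM p) :
    metric R p u v = metric R p v u := by
  simp only [metric, real_inner_comm (sphereIncl p.2 u.2), mul_comm u.1]

/-- The real vector space of all Killing fields. -/
def killing (R : ℝ → ℝ) : Submodule ℝ VectorField where
  carrier := {X | IsKilling R X}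
  zero_mem' := by
    refine ⟨Bundle.contMDiff_zeroSection ℝ (TangentSpace modelM : Universe → Type), ?_⟩
    intro Y Z _ _ p
    have h0 : ∀ v, metric R p 0 v = 0 := fun v => by
      simpa using metric_smul_left R p 0 0 v
    simp [lieDerivMetric, VectorField.mlieBracket_zero_left, h0, metric_comm R p (Y p)]
  add_mem' := by
    rintro X X' ⟨hX, hX'⟩ ⟨hX2, hX2'⟩
    refine ⟨ContMDiff.add_section hX hX2, ?_⟩
    intro Y Z hY hZ p
    have h1 := hX' Y Z hY hZ p
    have h2 := hX2' Y Z hY hZ p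
    simp only [lieDerivMetric] at h1 h2 ⊢
    rw [VectorField.mlieBracket_add_left (hX.mdifferentiableAt p) (hX2.mdifferentiableAt p),
      VectorField.mlieBracket_add_left (hX.mdifferentiableAt p) (hX2.mdifferentiableAt p),
      metric_add_left, metric_comm R p (Y p), metric_add_left, Pi.add_apply, map_add]
    rw [metric_comm R p (Y p)] at h1 h2
    linarith
  smul_mem' := by
    rintro c X ⟨hX, hX'⟩
    refine ⟨ContMDiff.const_smul_section hX, ?_⟩
    intro Y Z hY hZ p
    have h1 := hX' Y Z hY hZ p
    simp only [lieDerivMetric] at h1 ⊢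
    rw [VectorField.mlieBracket_const_smul_left (hX.mdifferentiableAt p),
      VectorField.mlieBracket_const_smul_left (hX.mdifferentiableAt p),
      metric_smul_left, metric_comm R p (Y p), metric_smul_left, Pi.smul_apply, map_smul,
      smul_eq_mul]
    rw [metric_comm R p (Y p)] at h1
    linear_combination c * h1

/-- Time-like vector fields: `g (X, X) > 0` at every point. -/
def IsTimelike (R : ℝ → ℝ) (X : VectorField) : Prop :=
  ∀ p : Universe, 0 < metric R p (X p) (X p)

/-- Space-like vector fields: `g (X, X) < 0` at every point where `X` does not vanish. -/
def IsSpacelike (R : ℝ → ℝ) (X : VectorField) : Prop :=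
  ∀ p : Universe, X p ≠ 0 → metric R p (X p) (X p) < 0

/-- The coordinate field `∂/∂x⁰`. -/
def timeField : VectorField := fun _ => ((1 : ℝ), (0 : E3))

/-- The rotation of `ℝ⁴` by the angle `θ` in the plane `zᵃ O zᵇ`, from the axis `a` to the
axis `b`; here `a ≠ b`. -/
def rotateE4 (a b : Fin 4) (θ : ℝ) (z : E4) : E4 :=
  WithLp.toLp 2 fun i =>
    if i = a then Real.cos θ * z a - Real.sin θ * z b
    else if i = b then Real.sin θ * z a + Real.cos θ * z b
    else z i

lemma rotateE4_mem {a b : Fin 4} (hab : a ≠ b) (θ : ℝ) (z : S3) :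
    rotateE4 a b θ z ∈ Metric.sphere (0 : E4) 1 := by
  have hz : ‖(z : E4)‖ ^ 2 = 1 := by simp
  rw [EuclideanSpace.real_norm_sq_eq, Fin.sum_univ_four] at hz
  have h := Real.sin_sq_add_cos_sq θ
  have : ‖rotateE4 a b θ z‖ ^ 2 = 1 := by
    rw [EuclideanSpace.real_norm_sq_eq, Fin.sum_univ_four]
    fin_cases a <;> fin_cases b <;> first | exact absurd rfl hab | skip
    all_goals
      simp [rotateE4]
      first
        | linear_combination hz + ((z : E4) 0 ^ 2 + (z : E4) 1 ^ 2) * h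
        | linear_combination hz + ((z : E4) 0 ^ 2 + (z : E4) 2 ^ 2) * h
        | linear_combination hz + ((z : E4) 0 ^ 2 + (z : E4) 3 ^ 2) * h
        | linear_combination hz + ((z : E4) 1 ^ 2 + (z : E4) 2 ^ 2) * h
        | linear_combination hz + ((z : E4) 1 ^ 2 + (z : E4) 3 ^ 2) * h
        | linear_combination hz + ((z : E4) 2 ^ 2 + (z : E4) 3 ^ 2) * h
  rw [mem_sphere_zero_iff_norm]
  nlinarith [norm_nonneg (rotateE4 a b θ z)]

/-- The rotation of the sphere `S³` by the angle `θ` in the plane `zᵃ O zᵇ`. -/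
def rotateS3 {a b : Fin 4} (hab : a ≠ b) (θ : ℝ) (z : S3) : S3 :=
  ⟨rotateE4 a b θ z, rotateE4_mem hab θ z⟩

/-- The vector field on `M` produced by the rotations of the sphere `S³` in the plane `zᵃ O zᵇ`:
its value at `(x⁰, z)` is the velocity at `θ = 0` of the curve `θ ↦ (x⁰, rotation of z by θ)`. -/
def planeRotationField {a b : Fin 4} (hab : a ≠ b) : VectorField := fun p =>
  ((0 : ℝ), (mfderiv 𝓘(ℝ, ℝ) (𝓡 3) (fun θ : ℝ => rotateS3 hab θ p.2) 0 (1 : ℝ) : E3))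

/-- The six rotation fields: the three meridional rotations (in the planes `z¹ O z⁴`, `z² O z⁴`,
`z³ O z⁴`) and the three equatorial ones (in the planes `z¹ O z²`, `z² O z³`, `z³ O z¹`), with
orientations such that their expressions in north pole stereographic coordinates are those
of `rotationCoord`, see `rotationField_north`. -/
def rotationField : Fin 6 → VectorField :=
  ![planeRotationField (a := 0) (b := 3) (by decide),
    planeRotationField (a := 1) (b := 3) (by decide),
    planeRotationField (a := 2) (b := 3) (by decide),
    planeRotationField (a := 1) (b := 0) (by decide),
    planeRotationField (a := 2) (b := 1) (by decide),
    planeRotationField (a := 0) (b := 2) (by decide)]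

/-! The stereographic coordinates and the coordinate expressions of the objects above. -/

/-- The point of `ℝ⁴` with the coordinates
`zⁱ = 2 xⁱ / (|x|² + 1)`, `i = 1, 2, 3`, and `z⁴ = ε (|x|² - 1) / (|x|² + 1)`. -/
def stereoE4 (ε : ℝ) (x : E3) : E4 :=
  !₂[2 * x 0 / (‖x‖ ^ 2 + 1), 2 * x 1 / (‖x‖ ^ 2 + 1), 2 * x 2 / (‖x‖ ^ 2 + 1),
    ε * (‖x‖ ^ 2 - 1) / (‖x‖ ^ 2 + 1)]

lemma stereoE4_mem {ε : ℝ} (hε : ε ^ 2 = 1) (x : E3) :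
    stereoE4 ε x ∈ Metric.sphere (0 : E4) 1 := by
  have hx : ‖x‖ ^ 2 + 1 ≠ 0 := by positivity
  have hx' := EuclideanSpace.real_norm_sq_eq x
  rw [Fin.sum_univ_three] at hx'
  have : ‖stereoE4 ε x‖ ^ 2 = 1 := by
    rw [EuclideanSpace.real_norm_sq_eq, Fin.sum_univ_four]
    simp [stereoE4]
    field_simp
    rw [hε]
    linear_combination (-4) * hx'
  rw [mem_sphere_zero_iff_norm]
  nlinarith [norm_nonneg (stereoE4 ε x)]

/-- The point of `S³` with given north pole stereographic coordinates (all of `S³` except the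
north pole `z⁴ = 1` is covered). -/
def north (x : E3) : S3 := ⟨stereoE4 1 x, stereoE4_mem (by norm_num) x⟩

/-- The point of `S³` with given south pole stereographic coordinates (all of `S³` except the
south pole `z⁴ = -1` is covered). -/
def south (y : E3) : S3 := ⟨stereoE4 (-1) y, stereoE4_mem (by norm_num) y⟩

/-- The transition between the two coordinate systems is `y = x / |x|²`. -/
lemma north_eq_south (x : E3) (hx : x ≠ 0) : north x = south ((‖x‖ ^ 2)⁻¹ • x) := by
  have hx0 : ‖x‖ ≠ 0 := norm_ne_zero_iff.mpr hx
  apply Subtype.ext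
  ext i
  fin_cases i <;> simp [north, south, stereoE4, norm_smul] <;> field_simp <;> ring

/-- The image in `ℝ⁴` of the coordinate vector `u` at `x`. -/
def stereoDeriv (ε : ℝ) (x u : E3) : E4 :=
  !₂[(2 * u 0 * (‖x‖ ^ 2 + 1) - 4 * x 0 * inner ℝ x u) / (‖x‖ ^ 2 + 1) ^ 2,
    (2 * u 1 * (‖x‖ ^ 2 + 1) - 4 * x 1 * inner ℝ x u) / (‖x‖ ^ 2 + 1) ^ 2,
    (2 * u 2 * (‖x‖ ^ 2 + 1) - 4 * x 2 * inner ℝ x u) / (‖x‖ ^ 2 + 1) ^ 2,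
    ε * (4 * inner ℝ x u) / (‖x‖ ^ 2 + 1) ^ 2]

lemma contDiff_stereoE4 (ε : ℝ) : ContDiff ℝ ∞ (stereoE4 ε) := by
  have hx : ∀ x : E3, ‖x‖ ^ 2 + 1 ≠ 0 := fun x => by positivity
  have h1 : ContDiff ℝ ∞ (fun x : E3 => ‖x‖ ^ 2 + 1) := (contDiff_norm_sq ℝ).add contDiff_const
  have h2 : ContDiff ℝ ∞ (fun x : E3 => ‖x‖ ^ 2 - 1) := (contDiff_norm_sq ℝ).sub contDiff_const
  have hc : ∀ i : Fin 3, ContDiff ℝ ∞ (fun x : E3 => x i) := fun i =>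
    (EuclideanSpace.proj (𝕜 := ℝ) i).contDiff
  rw [contDiff_euclidean]
  intro i
  fin_cases i
  · exact (contDiff_const.mul (hc 0)).div h1 hx
  · exact (contDiff_const.mul (hc 1)).div h1 hx
  · exact (contDiff_const.mul (hc 2)).div h1 hx
  · exact (contDiff_const.mul h2).div h1 hx

lemma hasDerivAt_of_coord {g : ℝ → E4} {g' : E4} {s : ℝ}
    (h : ∀ i, HasDerivAt (fun r => g r i) (g' i) s) : HasDerivAt g g' s :=
  (PiLp.continuousLinearEquiv 2 ℝ (fun _ : Fin 4 => ℝ)).symm.hasFDerivAt.comp_hasDerivAt s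
    (hasDerivAt_pi.2 h)

lemma fderiv_stereoE4 (ε : ℝ) (x u : E3) : fderiv ℝ (stereoE4 ε) x u = stereoDeriv ε x u := by
  have hx : ‖x‖ ^ 2 + 1 ≠ 0 := by positivity
  have hd : HasFDerivAt (stereoE4 ε) (fderiv ℝ (stereoE4 ε) x) x :=
    ((contDiff_stereoE4 ε).differentiable (by simp) x).hasFDerivAt
  have hl : HasDerivAt (fun s : ℝ => x + s • u) u 0 := by
    simpa using ((hasDerivAt_id (0 : ℝ)).smul_const u).const_add x
  have hN : HasDerivAt (fun s : ℝ => ‖x + s • u‖ ^ 2) (2 * inner ℝ x u) 0 := by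
    simpa using hl.norm_sq
  have hc : ∀ i : Fin 3, HasDerivAt (fun s : ℝ => (x + s • u) i) (u i) 0 := fun i =>
    (EuclideanSpace.proj (𝕜 := ℝ) i).hasFDerivAt.comp_hasDerivAt (0 : ℝ) hl
  have h1 : HasDerivAt (fun s : ℝ => stereoE4 ε (x + s • u)) (fderiv ℝ (stereoE4 ε) x u) 0 :=
    HasFDerivAt.comp_hasDerivAt (l := stereoE4 ε) (f := fun s : ℝ => x + s • u) (0 : ℝ)
      (by simpa using hd) hl
  refine h1.unique (hasDerivAt_of_coord ?_)
  have hx' : ‖x + (0 : ℝ) • u‖ ^ 2 + 1 ≠ 0 := by positivity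
  have e3 : ∀ i : Fin 3,
      HasDerivAt (fun s : ℝ => 2 * (x + s • u) i / (‖x + s • u‖ ^ 2 + 1)) _ 0 := fun i =>
    ((hc i).const_mul 2).div (hN.add_const 1) hx'
  have e1 : HasDerivAt
      (fun s : ℝ => ε * (‖x + s • u‖ ^ 2 - 1) / (‖x + s • u‖ ^ 2 + 1)) _ 0 :=
    ((hN.sub_const 1).const_mul ε).div (hN.add_const 1) hx'
  intro i
  fin_cases i
  · convert! e3 0 using 1
    simp [stereoDeriv]
    ring
  · convert! e3 1 using 1
    simp [stereoDeriv]
    ring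
  · convert! e3 2 using 1
    simp [stereoDeriv]
    ring
  · convert! e1 using 1
    simp [stereoDeriv]
    ring

lemma inner_stereoDeriv {ε : ℝ} (hε : ε ^ 2 = 1) (x u v : E3) :
    inner ℝ (stereoDeriv ε x u) (stereoDeriv ε x v) = 4 * inner ℝ u v / (‖x‖ ^ 2 + 1) ^ 2 := by
  have hx : ‖x‖ ^ 2 + 1 ≠ 0 := by positivity
  have hx' := EuclideanSpace.real_norm_sq_eq x
  rw [Fin.sum_univ_three] at hx'
  have hi : ∀ u v : E3, inner ℝ u v = u 0 * v 0 + u 1 * v 1 + u 2 * v 2 := fun u v => by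
    simp [PiLp.inner_apply, Fin.sum_univ_three, mul_comm]
  rw [PiLp.inner_apply, Fin.sum_univ_four]
  simp only [stereoDeriv]
  simp
  rw [hi x u, hi x v, hi u v, hx']
  rw [hx'] at hx
  field_simp
  ring_nf
  rw [hε]
  ring

lemma finrank_E4 : Fact (Module.finrank ℝ E4 = 3 + 1) := ⟨by simp⟩

lemma contMDiff_north : ContMDiff 𝓘(ℝ, E3) (𝓡 3) ∞ north :=
  have := finrank_E4
  ContMDiff.codRestrict_sphere (contDiff_stereoE4 1).contMDiff (fun x => (north x).2)

lemma contMDiff_south : ContMDiff 𝓘(ℝ, E3) (𝓡 3) ∞ south :=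
  have := finrank_E4
  ContMDiff.codRestrict_sphere (contDiff_stereoE4 (-1)).contMDiff (fun x => (south x).2)

/-- The tangent vector of `S³` at `north x` with components `u` in the north pole coordinates. -/
def northVec (x u : E3) : TangentSpace (𝓡 3) (north x) := mfderiv 𝓘(ℝ, E3) (𝓡 3) north x u

/-- The tangent vector of `S³` at `south y` with components `u` in the south pole coordinates. -/
def southVec (y u : E3) : TangentSpace (𝓡 3) (south y) := mfderiv 𝓘(ℝ, E3) (𝓡 3) south y u

lemma sphereIncl_mfderiv {E : Type*} [NormedAddCommGroup E] [NormedSpace ℝ E] {f : E → S3} {x : E}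
    (hf : MDifferentiableAt 𝓘(ℝ, E) (𝓡 3) f x) (u : E) :
    sphereIncl (f x) (mfderiv 𝓘(ℝ, E) (𝓡 3) f x u) = fderiv ℝ (fun y => (f y : E4)) x u := by
  have := finrank_E4
  have hc : MDifferentiableAt (𝓡 3) 𝓘(ℝ, E4) ((↑) : S3 → E4) (f x) :=
    (contMDiff_coe_sphere (m := 1) (f x)).mdifferentiableAt one_ne_zero
  have h := mfderiv_comp x hc hf
  have h2 := congrArg (fun L => L u) h
  rw [mfderiv_eq_fderiv] at h2
  exact h2.symm

/-- The metric in north pole stereographic coordinates. -/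
lemma metric_north (R : ℝ → ℝ) (t : ℝ) (x : E3) (u₀ v₀ : ℝ) (u v : E3) :
    metric R (t, north x) (u₀, northVec x u) (v₀, northVec x v) =
      R t ^ 2 * (u₀ * v₀) -
        4 * R t ^ 2 * (u 0 * v 0 + u 1 * v 1 + u 2 * v 2) / (‖x‖ ^ 2 + 1) ^ 2 := by
  have h : ∀ w, sphereIncl (north x) (northVec x w) = stereoDeriv 1 x w := fun w => by
    rw [← fderiv_stereoE4]
    exact sphereIncl_mfderiv ((contMDiff_north x).mdifferentiableAt (by simp)) w
  simp only [metric, h]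
  rw [inner_stereoDeriv (by norm_num)]
  simp [PiLp.inner_apply, Fin.sum_univ_three]
  ring

/-- The metric in south pole stereographic coordinates. -/
lemma metric_south (R : ℝ → ℝ) (t : ℝ) (y : E3) (u₀ v₀ : ℝ) (u v : E3) :
    metric R (t, south y) (u₀, southVec y u) (v₀, southVec y v) =
      R t ^ 2 * (u₀ * v₀) -
        4 * R t ^ 2 * (u 0 * v 0 + u 1 * v 1 + u 2 * v 2) / (‖y‖ ^ 2 + 1) ^ 2 := by
  have h : ∀ w, sphereIncl (south y) (southVec y w) = stereoDeriv (-1) y w := fun w => by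
    rw [← fderiv_stereoE4]
    exact sphereIncl_mfderiv ((contMDiff_south y).mdifferentiableAt (by simp)) w
  simp only [metric, h]
  rw [inner_stereoDeriv (by norm_num)]
  simp [PiLp.inner_apply, Fin.sum_univ_three]
  ring

/-- The components of the six rotation fields with respect to `∂/∂x¹, ∂/∂x², ∂/∂x³` in the north
pole stereographic coordinates. -/
def rotationCoord (x : E3) : Fin 6 → E3 :=
  ![!₂[(2 * x 0 ^ 2 - ‖x‖ ^ 2 + 1) / 2, x 0 * x 1, x 0 * x 2],
    !₂[x 1 * x 0, (2 * x 1 ^ 2 - ‖x‖ ^ 2 + 1) / 2, x 1 * x 2],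
    !₂[x 2 * x 0, x 2 * x 1, (2 * x 2 ^ 2 - ‖x‖ ^ 2 + 1) / 2],
    !₂[x 1, -x 0, 0],
    !₂[0, x 2, -x 1],
    !₂[-x 2, 0, x 0]]

/-- The derivative at `θ = 0` of the rotation by `θ`. -/
def rotVec (a b : Fin 4) (z : E4) : E4 :=
  WithLp.toLp 2 fun i => if i = a then -z b else if i = b then z a else 0

lemma contDiff_rotateE4 (a b : Fin 4) (z : E4) : ContDiff ℝ ∞ (fun θ => rotateE4 a b θ z) := by
  rw [contDiff_euclidean]
  intro i
  simp only [rotateE4]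
  split_ifs
  · exact (Real.contDiff_cos.mul contDiff_const).sub (Real.contDiff_sin.mul contDiff_const)
  · exact (Real.contDiff_sin.mul contDiff_const).add (Real.contDiff_cos.mul contDiff_const)
  · exact contDiff_const

lemma rotateS3_zero {a b : Fin 4} (hab : a ≠ b) (z : S3) : rotateS3 hab 0 z = z := by
  apply Subtype.ext
  ext i
  simp only [rotateS3, rotateE4]
  split_ifs with h1 h2 <;> simp_all

lemma sphereIncl_planeRotationField {a b : Fin 4} (hab : a ≠ b) (t : ℝ) (z : S3) :
    sphereIncl z (planeRotationField hab (t, z)).2 = rotVec a b z := by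
  have := finrank_E4
  have hs : ContMDiff 𝓘(ℝ, ℝ) (𝓡 3) ∞ (fun θ : ℝ => rotateS3 hab θ z) :=
    ContMDiff.codRestrict_sphere (contDiff_rotateE4 a b z).contMDiff
      (fun θ => (rotateS3 hab θ z).2)
  have h := sphereIncl_mfderiv ((hs 0).mdifferentiableAt (by simp)) (1 : ℝ)
  rw [rotateS3_zero] at h
  refine h.trans ?_
  have hd : HasDerivAt (fun θ => rotateE4 a b θ z) (rotVec a b z) 0 := by
    refine hasDerivAt_of_coord fun i => ?_
    simp only [rotateE4, rotVec]
    split_ifs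
    · simpa using ((Real.hasDerivAt_cos 0).mul_const ((z : E4) a)).fun_sub
        ((Real.hasDerivAt_sin 0).mul_const ((z : E4) b))
    · simpa using ((Real.hasDerivAt_sin 0).mul_const ((z : E4) a)).fun_add
        ((Real.hasDerivAt_cos 0).mul_const ((z : E4) b))
    · exact hasDerivAt_const _ _
  rw [fderiv_apply_one_eq_deriv]
  exact hd.deriv

/-- The rotation fields in north pole stereographic coordinates. -/
lemma rotationField_north (k : Fin 6) (t : ℝ) (x : E3) :
    rotationField k (t, north x) = ((0 : ℝ), northVec x (rotationCoord x k)) := by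
  have hx : ‖x‖ ^ 2 + 1 ≠ 0 := by positivity
  have hx' := EuclideanSpace.real_norm_sq_eq x
  rw [Fin.sum_univ_three] at hx'
  have hn : ∀ w, sphereIncl (north x) (northVec x w) = stereoDeriv 1 x w := fun w => by
    rw [← fderiv_stereoE4]
    exact sphereIncl_mfderiv ((contMDiff_north x).mdifferentiableAt (by simp)) w
  have key : ∀ {a b : Fin 4} (hab : a ≠ b) (w : E3),
      rotVec a b (stereoE4 1 x) = stereoDeriv 1 x w →
      planeRotationField hab (t, north x) = ((0 : ℝ), northVec x w) := by
    intro a b hab w hw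
    have := finrank_E4
    refine Prod.ext rfl ?_
    apply injective_mvfderiv_subtypeVal_sphere (north x)
    exact (sphereIncl_planeRotationField hab t (north x)).trans (hw.trans (hn w).symm)
  have hi : ∀ u v : E3, inner ℝ u v = u 0 * v 0 + u 1 * v 1 + u 2 * v 2 := fun u v => by
    simp [PiLp.inner_apply, Fin.sum_univ_three, mul_comm]
  fin_cases k <;> refine key _ _ ?_ <;> ext i <;> fin_cases i <;>
    simp [rotVec, stereoE4, stereoDeriv, rotationCoord, hi] <;> field_simp <;>
    (try simp only [hx']) <;> ring

end ClosedUniverse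

end

/-!
The Killing fields of `M = ℝ × S³` with a constant radius are found by viewing a vector field `X` on
`M` as a function `ambient X : M → ℝ × ℝ⁴`, through the differential of the inclusion
`M ⊂ ℝ × ℝ⁴`. The metric becomes a constant multiple of the Lorentz form `lorentz` of `ℝ × ℝ⁴`, and
since the bracket acts on functions as a commutator (`mvfderiv_mlieBracket`), the Lie derivative
`(L_X g)(Y, Z)` becomes `lorentz (∂_Y X) Z + lorentz Y (∂_Z X)` up to that constant
(`lieDerivMetric_eq`). It vanishes as soon as `X` is the restriction of an affine field with
skew linear part, which is the case for the rotation fields and for `∂/∂x⁰`.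

For the converse, if `X` and `Y` are Killing fields and `Y` has constant length, then `g (X, Y)` is
constant along the integral curves of `Y` (`lorentz_ambient_const`). This is applied to the fields
`Y = a ∂/∂x⁰ + L_u`, where `L_u` is the left multiplication by a unit imaginary quaternion `u`:
they are combinations of the fields already known, and their integral curves are the helices
`s ↦ (t + a s, cos s z + sin s u z)` (`lorentz_helix_const`). The projections to `S³` of these
helices join any two points of the sphere (`exists_greatCircle`). Write `X = (f, V)`.

* The curves of `∂/∂x⁰` show that `f` does not depend on the time. After a full turn, `s = 2π`, the
  helices are back over their origin with any time shift, so `V` does not depend on the time either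
  (`ambient_snd_time`).
* The case `a = 0` gives `⟨V z, w⟩ + ⟨V w, z⟩ = 0` for all points `z`, `w` of the sphere
  (`inner_ambient_antisymm`). With `w = eᵢ`, the `i`-th coordinate of `V z` is `-⟨V eᵢ, z⟩`, which is
  linear in `z`: so `V z = A z` with a skew matrix `A`.
* Comparing the cases `a = 0` and `a = 1` shows that `f` is constant (`ambient_fst_const`).

So `X` is a combination of `∂/∂x⁰` and of the six rotation fields (`exists_eq_of_isKilling`), and the
values at the basis vectors show that these seven fields are linearly independent
(`linearIndependent_fields`).
-/

noncomputable section

namespace ClosedUniverse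

open VectorField Set Filter
open scoped Topology

/-! ### The bracket of vector fields as a commutator of derivations -/

section
variable {E : Type*} [NormedAddCommGroup E] [NormedSpace ℝ E] [CompleteSpace E]
  {H : Type*} [TopologicalSpace H] {I : ModelWithCorners ℝ E H}
  {M : Type*} [TopologicalSpace M] [ChartedSpace H M] [IsManifold I 2 M]
  {F : Type*} [NormedAddCommGroup F] [NormedSpace ℝ F]

omit [CompleteSpace E] in
/-- In the chart at `x`, the derivative of `f` along a vector field is the derivative of the local
expression of `f` along the local expression of the field. -/
lemma fderivWithin_mpullbackWithin_extChartAt {f : M → F} (hf : MDifferentiable I 𝓘(ℝ, F) f)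
    (V : (x : M) → TangentSpace I x) (x : M) {y : E} (hy : y ∈ (extChartAt I x).target) :
    fderivWithin ℝ (f ∘ (extChartAt I x).symm) (range I) y
      (mpullbackWithin 𝓘(ℝ, E) I (extChartAt I x).symm V (range I) y) =
    mvfderiv I f ((extChartAt I x).symm y) (V ((extChartAt I x).symm y)) := by
  have : IsManifold I 1 M := IsManifold.of_le (n := 2) one_le_two
  have hyr : y ∈ range I := extChartAt_target_subset_range x hy
  have hs : MDifferentiableWithinAt 𝓘(ℝ, E) I (extChartAt I x).symm (range I) y :=
    (contMDiffWithinAt_extChartAt_symm_range (n := 1) x hy).mdifferentiableWithinAt one_ne_zero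
  have h := mfderiv_comp_mfderivWithin (I'' := 𝓘(ℝ, F)) y (hf _) hs
    (I.uniqueDiffOn.uniqueMDiffOn y hyr)
  rw [mfderivWithin_eq_fderivWithin] at h
  have h2 := congrArg (fun L => L (mpullbackWithin 𝓘(ℝ, E) I (extChartAt I x).symm V (range I) y)) h
  refine h2.trans ?_
  show (mfderiv I 𝓘(ℝ, F) f _) (mfderivWithin _ _ _ _ _ _) = _
  rw [mpullbackWithin_apply, (isInvertible_mfderivWithin_extChartAt_symm hy).self_apply_inverse]
  rfl

/-- The bracket of two vector fields acts on vector-valued functions as the commutator of the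
derivations. -/
lemma mvfderiv_mlieBracket {f : M → F} (hf : ContMDiff I 𝓘(ℝ, F) 2 f)
    {V W : (x : M) → TangentSpace I x} {x : M}
    (hV : MDifferentiableAt I I.tangent (fun y => (⟨y, V y⟩ : TangentBundle I M)) x)
    (hW : MDifferentiableAt I I.tangent (fun y => (⟨y, W y⟩ : TangentBundle I M)) x)
    (hfV : MDifferentiableAt I 𝓘(ℝ, F) (fun y => mvfderiv I f y (V y)) x)
    (hfW : MDifferentiableAt I 𝓘(ℝ, F) (fun y => mvfderiv I f y (W y)) x) :
    mvfderiv I f x (mlieBracket I V W x) =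
      mvfderiv I (fun y => mvfderiv I f y (W y)) x (V x) -
        mvfderiv I (fun y => mvfderiv I f y (V y)) x (W x) := by
  have : IsManifold I 1 M := IsManifold.of_le (n := 2) one_le_two
  have hfd : MDifferentiable I 𝓘(ℝ, F) f := hf.mdifferentiable two_ne_zero
  set φ := extChartAt I x with hφ
  have hx : φ x ∈ range I := mem_range_self _
  set V' := mpullbackWithin 𝓘(ℝ, E) I φ.symm V (range I) with hV'
  set W' := mpullbackWithin 𝓘(ℝ, E) I φ.symm W (range I) with hW'
  have dV : DifferentiableWithinAt ℝ V' (range I) (φ x) := by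
    have := MDifferentiableWithinAt.differentiableWithinAt_mpullbackWithin_vectorField
      (s := univ) hV.mdifferentiableWithinAt
    rwa [preimage_univ, univ_inter] at this
  have dW : DifferentiableWithinAt ℝ W' (range I) (φ x) := by
    have := MDifferentiableWithinAt.differentiableWithinAt_mpullbackWithin_vectorField
      (s := univ) hW.mdifferentiableWithinAt
    rwa [preimage_univ, univ_inter] at this
  have hfc : ContDiffWithinAt ℝ 2 (f ∘ φ.symm) (range I) (φ x) := (contMDiffAt_iff.1 (hf x)).2
  have key := fderivWithin_apply_lieBracket hfc (by simp) I.uniqueDiffOn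
    (I.range_subset_closure_interior hx) hx dW dV
  have hsm : ∀ (U : (x : M) → TangentSpace I x),
      (fun y => fderivWithin ℝ (f ∘ φ.symm) (range I) y
        (mpullbackWithin 𝓘(ℝ, E) I φ.symm U (range I) y)) =ᶠ[𝓝[range I] (φ x)]
      ((fun y => mvfderiv I f y (U y)) ∘ φ.symm) := fun U => by
    filter_upwards [extChartAt_target_mem_nhdsWithin x] with y hy
    exact fderivWithin_mpullbackWithin_extChartAt hfd U x hy
  have hVx : V' (φ x) = V x := by
    have h := mfderivWithin_extChartAt_symm_inverse_apply (I := I) (x := x) (V x)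
    rw [hV', mpullbackWithin_apply, hφ, extChartAt_to_inv]
    exact h
  have hWx : W' (φ x) = W x := by
    have h := mfderivWithin_extChartAt_symm_inverse_apply (I := I) (x := x) (W x)
    rw [hW', mpullbackWithin_apply, hφ, extChartAt_to_inv]
    exact h
  have hbr : mlieBracket I V W x = lieBracketWithin ℝ V' W' (range I) (φ x) := by
    rw [← mlieBracketWithin_univ, mlieBracketWithin_apply, mfderiv_extChartAt_self, preimage_univ,
      univ_inter]
    exact congrArg (fun L : E →L[ℝ] E => L (lieBracketWithin ℝ V' W' (range I) (φ x)))
      ContinuousLinearMap.inverse_id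
  have hd : ∀ (g : M → F), MDifferentiableAt I 𝓘(ℝ, F) g x → ∀ v : TangentSpace I x,
      mvfderiv I g x v = fderivWithin ℝ (g ∘ φ.symm) (range I) (φ x) v := fun g hg v => by
    rw [hg.mvfderiv]
    rfl
  rw [(hsm V).fderivWithin_eq_of_mem hx, (hsm W).fderivWithin_eq_of_mem hx, hVx, hWx] at key
  rw [hd f (hfd x), hd _ hfV, hd _ hfW, hbr]
  exact key
end

/-! ### Vector fields on `M` as functions with values in `ℝ × ℝ⁴` -/

lemma mvfderiv_prodMk_space {F G : Type*} [NormedAddCommGroup F] [NormedSpace ℝ F]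
    [NormedAddCommGroup G] [NormedSpace ℝ G] {f : Universe → F} {g : Universe → G} {p : Universe}
    (hf : MDifferentiableAt modelM 𝓘(ℝ, F) f p) (hg : MDifferentiableAt modelM 𝓘(ℝ, G) g p)
    (v : TangentSpace modelM p) :
    mvfderiv modelM (fun q => (f q, g q)) p v = (mvfderiv modelM f p v, mvfderiv modelM g p v) := by
  have h : HasMFDerivAt modelM 𝓘(ℝ, F × G) (fun q => (f q, g q)) p
      ((mfderiv modelM 𝓘(ℝ, F) f p).prod (mfderiv modelM 𝓘(ℝ, G) g p)) :=
    ⟨hf.continuousAt.prodMk hg.continuousAt, hf.hasMFDerivAt.2.prodMk hg.hasMFDerivAt.2⟩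
  exact congrArg (fun L => L v) h.mfderiv

/-- The inclusion of `M = ℝ × S³` into the flat space `ℝ × ℝ⁴`. -/
def incl (p : Universe) : ℝ × E4 := (p.1, p.2)

lemma contMDiff_incl : ContMDiff modelM 𝓘(ℝ, ℝ × E4) ∞ incl :=
  have := finrank_E4
  contMDiff_fst.prodMk_space (contMDiff_coe_sphere.comp contMDiff_snd)

lemma mvfderiv_incl (p : Universe) (v : TangentSpace modelM p) :
    mvfderiv modelM incl p v = (v.1, sphereIncl p.2 v.2) := by
  have := finrank_E4
  have h1 : MDifferentiableAt modelM 𝓘(ℝ, ℝ) (fun q : Universe => q.1) p := mdifferentiableAt_fst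
  have hc : MDifferentiableAt (𝓡 3) 𝓘(ℝ, E4) ((↑) : S3 → E4) p.2 :=
    (contMDiff_coe_sphere (m := 1) p.2).mdifferentiableAt one_ne_zero
  have h2 : MDifferentiableAt modelM 𝓘(ℝ, E4) (fun q : Universe => (q.2 : E4)) p :=
    hc.comp p mdifferentiableAt_snd
  have h3 := mfderiv_comp_apply p hc (mdifferentiableAt_snd (I := 𝓘(ℝ, ℝ))) v
  rw [mfderiv_snd] at h3
  have h4 := mvfderiv_prodMk_space h1 h2 v
  rw [mvfderiv, mvfderiv, mfderiv_fst] at h4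
  have h5 : mfderiv modelM 𝓘(ℝ, E4) (fun q : Universe => (q.2 : E4)) p v =
    sphereIncl p.2 v.2 := h3
  refine Eq.trans ?_ (congrArg (Prod.mk v.1) h5)
  exact h4

lemma mvfderiv_incl_injective (p : Universe) : Function.Injective (mvfderiv modelM incl p) := by
  intro u v h
  have := finrank_E4
  rw [mvfderiv_incl, mvfderiv_incl, Prod.mk.injEq] at h
  exact Prod.ext h.1 (injective_mvfderiv_subtypeVal_sphere p.2 h.2)

/-- A vector field on `M`, seen as a function with values in `ℝ × ℝ⁴`. -/
def ambient (X : VectorField) (p : Universe) : ℝ × E4 := mvfderiv modelM incl p (X p)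

lemma ambient_apply (X : VectorField) (p : Universe) :
    ambient X p = ((X p).1, sphereIncl p.2 (X p).2) := mvfderiv_incl p (X p)

lemma IsSmooth.contMDiff_ambient {X : VectorField} (hX : IsSmooth X) :
    ContMDiff modelM 𝓘(ℝ, ℝ × E4) ∞ (ambient X) := by
  have := finrank_E4
  have h1 : ContMDiff modelM.tangent 𝓘(ℝ, ℝ × E4).tangent ∞
      (tangentMap modelM 𝓘(ℝ, ℝ × E4) incl) :=
    contMDiff_incl.contMDiff_tangentMap (by simp)
  have h2 := h1.comp hX
  exact (contMDiff_snd_tangentBundle_modelSpace (ℝ × E4) 𝓘(ℝ, ℝ × E4)).comp h2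

/-- The spatial part of a vector field is tangent to the sphere. -/
lemma inner_ambient (X : VectorField) (p : Universe) :
    inner ℝ (p.2 : E4) (ambient X p).2 = 0 := by
  have := finrank_E4
  have h : sphereIncl p.2 (X p).2 ∈ (mvfderiv (𝓡 3) ((↑) : S3 → E4) p.2).range := ⟨_, rfl⟩
  rw [range_mvfderiv_subtypeVal, Submodule.mem_orthogonal_singleton_iff_inner_right] at h
  rw [ambient_apply]
  exact h

/-- The Lorentz form of `ℝ × ℝ⁴`, with signature `(+, -, -, -, -)`. -/
def lorentz (u v : ℝ × E4) : ℝ := u.1 * v.1 - inner ℝ u.2 v.2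

lemma lorentz_sub_left (u v w : ℝ × E4) : lorentz (u - v) w = lorentz u w - lorentz v w := by
  simp only [lorentz, Prod.fst_sub, Prod.snd_sub, inner_sub_left]
  ring

lemma lorentz_comm (u v : ℝ × E4) : lorentz u v = lorentz v u := by
  simp only [lorentz, real_inner_comm u.2, mul_comm u.1]

lemma metric_eq_lorentz (R : ℝ → ℝ) (X Y : VectorField) (p : Universe) :
    metric R p (X p) (Y p) = R p.1 ^ 2 * lorentz (ambient X p) (ambient Y p) := by
  rw [ambient_apply, ambient_apply]
  rfl

lemma ambient_mlieBracket {X Y : VectorField} (hX : IsSmooth X) (hY : IsSmooth Y) (p : Universe) :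
    ambient (mlieBracket modelM X Y) p =
      mvfderiv modelM (ambient Y) p (X p) - mvfderiv modelM (ambient X) p (Y p) :=
  have := finrank_E4
  mvfderiv_mlieBracket (contMDiff_incl.of_le ENat.LEInfty.out) (hX.mdifferentiableAt p)
    (hY.mdifferentiableAt p) ((hX.contMDiff_ambient p).mdifferentiableAt (by simp))
    ((hY.contMDiff_ambient p).mdifferentiableAt (by simp))

lemma differentiableAt_lorentz (x : (ℝ × E4) × (ℝ × E4)) :
    DifferentiableAt ℝ (fun q : (ℝ × E4) × (ℝ × E4) => lorentz q.1 q.2) x := by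
  exact (DifferentiableAt.mul (by fun_prop) (by fun_prop)).sub
    (DifferentiableAt.inner ℝ (by fun_prop) (by fun_prop))

lemma fderiv_lorentz (x w : (ℝ × E4) × (ℝ × E4)) :
    fderiv ℝ (fun q : (ℝ × E4) × (ℝ × E4) => lorentz q.1 q.2) x w =
      lorentz w.1 x.2 + lorentz x.1 w.2 := by
  have h : HasFDerivAt (fun q : (ℝ × E4) × (ℝ × E4) => lorentz q.1 q.2) _ x :=
    ((hasFDerivAt_fst (p := x)).fst.mul (hasFDerivAt_snd (p := x)).fst).sub
      ((hasFDerivAt_fst (p := x)).snd.inner ℝ (hasFDerivAt_snd (p := x)).snd)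
  rw [h.fderiv]
  simp [lorentz, fderivInnerCLM_apply]
  ring

lemma mdifferentiableAt_lorentz {f g : Universe → ℝ × E4} {p : Universe}
    (hf : MDifferentiableAt modelM 𝓘(ℝ, ℝ × E4) f p)
    (hg : MDifferentiableAt modelM 𝓘(ℝ, ℝ × E4) g p) :
    MDifferentiableAt modelM 𝓘(ℝ, ℝ) (fun q => lorentz (f q) (g q)) p :=
  MDifferentiableAt.comp (I' := 𝓘(ℝ, (ℝ × E4) × (ℝ × E4)))
    (g := fun q : (ℝ × E4) × (ℝ × E4) => lorentz q.1 q.2) (f := fun q => (f q, g q)) p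
    (differentiableAt_lorentz _).mdifferentiableAt (hf.prodMk_space hg)

lemma mvfderiv_lorentz {f g : Universe → ℝ × E4} {p : Universe}
    (hf : MDifferentiableAt modelM 𝓘(ℝ, ℝ × E4) f p)
    (hg : MDifferentiableAt modelM 𝓘(ℝ, ℝ × E4) g p) (v : TangentSpace modelM p) :
    mvfderiv modelM (fun q => lorentz (f q) (g q)) p v =
      lorentz (mvfderiv modelM f p v) (g p) + lorentz (f p) (mvfderiv modelM g p v) := by
  have h := mfderiv_comp_apply (I' := 𝓘(ℝ, (ℝ × E4) × (ℝ × E4)))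
    (g := fun q : (ℝ × E4) × (ℝ × E4) => lorentz q.1 q.2) (f := fun q => (f q, g q)) p
    (differentiableAt_lorentz _).mdifferentiableAt (hf.prodMk_space hg) v
  rw [mfderiv_eq_fderiv] at h
  have h3 : mfderiv modelM 𝓘(ℝ, (ℝ × E4) × (ℝ × E4)) (fun q => (f q, g q)) p v =
    (mvfderiv modelM f p v, mvfderiv modelM g p v) := mvfderiv_prodMk_space hf hg v
  refine h.trans ((fderiv_lorentz _ _).trans ?_)
  rw [h3]

lemma lieDerivMetric_eq {R : ℝ → ℝ} {c : ℝ} (hR : ∀ t, R t = c) {X Y Z : VectorField}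
    (hX : IsSmooth X) (hY : IsSmooth Y) (hZ : IsSmooth Z) (p : Universe) :
    lieDerivMetric R X Y Z p = c ^ 2 *
      (lorentz (mvfderiv modelM (ambient X) p (Y p)) (ambient Z p) +
        lorentz (ambient Y p) (mvfderiv modelM (ambient X) p (Z p))) := by
  have hYd := (hY.contMDiff_ambient p).mdifferentiableAt (by simp)
  have hZd := (hZ.contMDiff_ambient p).mdifferentiableAt (by simp)
  have hg : (fun q : Universe => metric R q (Y q) (Z q)) =
      fun q => c ^ 2 * lorentz (ambient Y q) (ambient Z q) := by
    funext q
    rw [metric_eq_lorentz, hR]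
  have hm : mvfderiv modelM (fun q : Universe => metric R q (Y q) (Z q)) p (X p) =
      c ^ 2 * mvfderiv modelM (fun q => lorentz (ambient Y q) (ambient Z q)) p (X p) := by
    rw [hg, mvfderiv_fun_mul mdifferentiableAt_const (mdifferentiableAt_lorentz hYd hZd),
      mvfderiv_const]
    simp
  rw [lieDerivMetric, hm, metric_eq_lorentz, metric_eq_lorentz, ambient_mlieBracket hX hY,
    ambient_mlieBracket hX hZ, mvfderiv_lorentz hYd hZd, hR, lorentz_sub_left,
    lorentz_comm (ambient Y p) (_ - _), lorentz_sub_left, lorentz_comm (ambient Y p),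
    lorentz_comm (ambient Y p)]
  ring

/-! ### The fields `∂/∂x⁰` and the rotation fields are Killing fields -/

lemma ambient_add (X Y : VectorField) (p : Universe) :
    ambient (X + Y) p = ambient X p + ambient Y p := map_add (mvfderiv modelM incl p) (X p) (Y p)

lemma ambient_smul (c : ℝ) (X : VectorField) (p : Universe) :
    ambient (c • X) p = c • ambient X p := map_smul (mvfderiv modelM incl p) c (X p)

lemma ambient_injective : Function.Injective ambient := fun _ _ h =>
  funext fun p => mvfderiv_incl_injective p (congrFun h p)

lemma ambient_timeField (p : Universe) : ambient timeField p = (1, 0) := by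
  rw [ambient_apply]
  exact congrArg (Prod.mk 1) (map_zero (sphereIncl p.2))

lemma ambient_planeRotationField {a b : Fin 4} (hab : a ≠ b) (p : Universe) :
    ambient (planeRotationField hab) p = (0, rotVec a b p.2) := by
  rw [ambient_apply]
  exact congrArg (Prod.mk 0) (sphereIncl_planeRotationField hab p.1 p.2)

/-- A field with a time component depending only on the time and a spatial component depending only
on the point of the sphere is smooth if these components are. -/
lemma isSmooth_prodMk {f : ℝ → ℝ} {V : (z : S3) → TangentSpace (𝓡 3) z} (hf : ContDiff ℝ ∞ f)
    (hV : ContMDiff (𝓡 3) (𝓡 3).tangent ∞ (fun z => (⟨z, V z⟩ : TangentBundle (𝓡 3) S3))) :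
    IsSmooth (fun p => (f p.1, V p.2)) := by
  have := finrank_E4
  have h1 : ContMDiff 𝓘(ℝ, ℝ) 𝓘(ℝ, ℝ).tangent ∞
      (fun t : ℝ => (⟨t, f t⟩ : TangentBundle 𝓘(ℝ, ℝ) ℝ)) :=
    contMDiff_vectorSpace_iff_contDiff.2 hf
  exact (contMDiff_equivTangentBundleProd_symm (I := 𝓘(ℝ, ℝ)) (I' := 𝓡 3) (M := ℝ) (M' := S3)).comp
    ((h1.comp contMDiff_fst).prodMk (hV.comp contMDiff_snd))

lemma isSmooth_timeField : IsSmooth timeField :=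
  have := finrank_E4
  isSmooth_prodMk (f := fun _ => 1) (V := fun _ => 0) contDiff_const
    (Bundle.contMDiff_zeroSection ℝ (TangentSpace (𝓡 3) : S3 → Type))

lemma contDiff_uncurry_rotateE4 (a b : Fin 4) :
    ContDiff ℝ ∞ (fun q : ℝ × E4 => rotateE4 a b q.1 q.2) := by
  rw [contDiff_euclidean]
  intro i
  have hc : ∀ j : Fin 4, ContDiff ℝ ∞ (fun q : ℝ × E4 => q.2 j) := fun j =>
    (EuclideanSpace.proj (𝕜 := ℝ) j).contDiff.comp contDiff_snd
  have hcos : ContDiff ℝ ∞ (fun q : ℝ × E4 => Real.cos q.1) := Real.contDiff_cos.comp contDiff_fst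
  have hsin : ContDiff ℝ ∞ (fun q : ℝ × E4 => Real.sin q.1) := Real.contDiff_sin.comp contDiff_fst
  simp only [rotateE4]
  split_ifs
  · exact (hcos.mul (hc a)).sub (hsin.mul (hc b))
  · exact (hsin.mul (hc a)).add (hcos.mul (hc b))
  · exact hc i

lemma contMDiff_rotateS3 {a b : Fin 4} (hab : a ≠ b) :
    ContMDiff modelM (𝓡 3) ∞ (fun q : Universe => rotateS3 hab q.1 q.2) := by
  have := finrank_E4
  have h : ContMDiff modelM 𝓘(ℝ, E4) ∞ (fun q : Universe => rotateE4 a b q.1 q.2) :=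
    ContMDiff.comp (g := fun q : ℝ × E4 => rotateE4 a b q.1 q.2) (f := incl)
      (contDiff_uncurry_rotateE4 a b).contMDiff contMDiff_incl
  exact h.codRestrict_sphere (fun q => (rotateS3 hab q.1 q.2).2)

/-- The field is the image of the field `(∂/∂θ, 0)` along `{0} × S³` under the tangent map of the
rotation map `ℝ × S³ → S³`. -/
lemma isSmooth_planeRotationField {a b : Fin 4} (hab : a ≠ b) :
    IsSmooth (planeRotationField hab) := by
  have := finrank_E4
  refine isSmooth_prodMk (f := fun _ => 0)
    (V := fun z => mfderiv 𝓘(ℝ, ℝ) (𝓡 3) (fun θ : ℝ => rotateS3 hab θ z) 0 (1 : ℝ))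
    contDiff_const ?_
  have h1 : ContMDiff (𝓡 3) 𝓘(ℝ, ℝ).tangent ∞
      (fun _ : S3 => (⟨0, 1⟩ : TangentBundle 𝓘(ℝ, ℝ) ℝ)) := contMDiff_const
  have h2 : ContMDiff (𝓡 3) (𝓡 3).tangent ∞
      (fun z : S3 => (⟨z, 0⟩ : TangentBundle (𝓡 3) S3)) :=
    Bundle.contMDiff_zeroSection ℝ (TangentSpace (𝓡 3) : S3 → Type)
  have h3 := ((contMDiff_rotateS3 hab).contMDiff_tangentMap (m := ∞) (by simp)).comp
    ((contMDiff_equivTangentBundleProd_symm (I := 𝓘(ℝ, ℝ)) (I' := 𝓡 3) (M := ℝ) (M' := S3)).comp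
      (h1.prodMk h2))
  convert! h3 using 2 with z
  refine Bundle.TotalSpace.ext (rotateS3_zero hab z).symm (heq_of_eq ?_)
  have h4 := mfderiv_comp_apply (I' := 𝓘(ℝ, ℝ).prod (𝓡 3)) (f := fun θ : ℝ => (θ, z)) (0 : ℝ)
    ((contMDiff_rotateS3 hab _).mdifferentiableAt (by simp))
    (mdifferentiableAt_id.prodMk mdifferentiableAt_const) (1 : ℝ)
  refine h4.trans ?_
  rw [mfderiv_prod_left]
  rfl

/-- The restriction to `M` of an affine field of `ℝ × ℝ⁴` whose linear part is skew for the Lorentz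
form is a Killing field, if it is tangent to `M`. -/
lemma isKilling_of_ambient {R : ℝ → ℝ} {c : ℝ} (hR : ∀ t, R t = c) {X : VectorField}
    (hX : IsSmooth X) (u : ℝ × E4) (T : (ℝ × E4) →L[ℝ] ℝ × E4)
    (hT : ∀ v w, lorentz (T v) w + lorentz v (T w) = 0)
    (h : ∀ p, ambient X p = u + T (incl p)) : IsKilling R X := by
  refine ⟨hX, fun Y Z hY hZ p => ?_⟩
  have hd : ∀ v : TangentSpace modelM p,
      mvfderiv modelM (ambient X) p v = T (mvfderiv modelM incl p v) := fun v => by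
    have h1 : HasFDerivAt (fun y => u + T y) T (incl p) := T.hasFDerivAt.const_add u
    have h2 := mfderiv_comp_apply p h1.differentiableAt.mdifferentiableAt
      ((contMDiff_incl p).mdifferentiableAt (by simp)) v
    rw [mfderiv_eq_fderiv, h1.fderiv] at h2
    rw [funext h]
    exact h2
  rw [lieDerivMetric_eq hR hX hY hZ, hd, hd]
  exact mul_eq_zero_of_right _ (hT _ _)

lemma inner_rotVec {a b : Fin 4} (hab : a ≠ b) (v w : E4) :
    inner ℝ (rotVec a b v) w + inner ℝ v (rotVec a b w) = 0 := by
  simp only [PiLp.inner_apply, Fin.sum_univ_four, rotVec]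
  fin_cases a <;> fin_cases b <;> first | exact absurd rfl hab | skip
  all_goals
    simp

/-- The derivative `rotVec a b` of the rotations in a plane of `ℝ⁴`, as a linear map of `ℝ × ℝ⁴`
which kills the time component. -/
def rotLin (a b : Fin 4) : (ℝ × E4) →L[ℝ] ℝ × E4 :=
  LinearMap.toContinuousLinearMap
    { toFun := fun u => (0, rotVec a b u.2)
      map_add' := fun u v => by
        refine Prod.ext (by simp) (PiLp.ext fun i => ?_)
        simp only [rotVec, Prod.snd_add, PiLp.add_apply, Prod.mk_add_mk]
        split_ifs <;> ring
      map_smul' := fun c u => by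
        refine Prod.ext (by simp) (PiLp.ext fun i => ?_)
        simp only [rotVec, Prod.smul_snd, PiLp.smul_apply, RingHom.id_apply, Prod.smul_mk,
          smul_eq_mul]
        split_ifs <;> ring }

lemma isKilling_planeRotationField {R : ℝ → ℝ} {c : ℝ} (hR : ∀ t, R t = c) {a b : Fin 4}
    (hab : a ≠ b) : IsKilling R (planeRotationField hab) := by
  refine isKilling_of_ambient hR (isSmooth_planeRotationField hab) 0 (rotLin a b)
    (fun v w => ?_) (fun p => ?_)
  · have := inner_rotVec hab v.2 w.2
    simp only [rotLin, lorentz, LinearMap.coe_toContinuousLinearMap', LinearMap.coe_mk,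
      AddHom.coe_mk]
    linarith
  · rw [ambient_planeRotationField, zero_add]
    rfl

lemma isKilling_timeField {R : ℝ → ℝ} {c : ℝ} (hR : ∀ t, R t = c) : IsKilling R timeField :=
  isKilling_of_ambient hR isSmooth_timeField (1, 0) 0 (fun v w => by simp [lorentz])
    (fun p => by rw [ambient_timeField]; simp)

/-! ### Conservation along the integral curves of a Killing field -/

/-- Noether's conservation law: the product of a Killing field `X` with a Killing field `Y` of
constant length is constant along the integral curves of `Y`. Indeed
`Y (g (X, Y)) = g ([Y, X], Y) = -X (g (Y, Y)) / 2 = 0`, by the Killing equations of `Y` and `X`. -/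
lemma lorentz_ambient_const {R : ℝ → ℝ} {c k : ℝ} (hR : ∀ t, R t = c) (hc : c ≠ 0)
    {X Y : VectorField} (hX : IsKilling R X) (hY : IsKilling R Y)
    (hk : ∀ p, lorentz (ambient Y p) (ambient Y p) = k) {γ : ℝ → Universe}
    (hγ : ContMDiff 𝓘(ℝ, ℝ) modelM ∞ γ)
    (hγ' : ∀ s, HasDerivAt (fun r => incl (γ r)) (ambient Y (γ s)) s) (s : ℝ) :
    lorentz (ambient X (γ s)) (ambient Y (γ s)) = lorentz (ambient X (γ 0)) (ambient Y (γ 0)) := by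
  have hc2 : c ^ 2 ≠ 0 := pow_ne_zero 2 hc
  have hXd := fun p => (hX.1.contMDiff_ambient p).mdifferentiableAt (by simp)
  have hYd := fun p => (hY.1.contMDiff_ambient p).mdifferentiableAt (by simp)
  have hzero : ∀ p, mvfderiv modelM (fun q => lorentz (ambient X q) (ambient Y q)) p (Y p) = 0 := by
    intro p
    have h1 := hX.2 Y Y hY.1 hY.1 p
    have h2 := hY.2 X Y hX.1 hY.1 p
    have h3 := mvfderiv_lorentz (hYd p) (hYd p) (X p)
    rw [lieDerivMetric_eq hR hX.1 hY.1 hY.1, lorentz_comm (ambient Y p)] at h1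
    rw [lieDerivMetric_eq hR hY.1 hX.1 hY.1] at h2
    rw [funext hk, mvfderiv_const, lorentz_comm (ambient Y p)] at h3
    have h1' := (mul_eq_zero.1 h1).resolve_left hc2
    have h2' := (mul_eq_zero.1 h2).resolve_left hc2
    have h3' : (0 : ℝ) = _ := h3
    rw [mvfderiv_lorentz (hXd p) (hYd p)]
    linarith
  have hvel : ∀ s, mfderiv 𝓘(ℝ, ℝ) modelM γ s (1 : ℝ) = Y (γ s) := fun s => by
    apply mvfderiv_incl_injective
    have h := mfderiv_comp_apply s ((contMDiff_incl (γ s)).mdifferentiableAt (by simp))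
      ((hγ s).mdifferentiableAt (by simp)) (1 : ℝ)
    rw [mfderiv_eq_fderiv] at h
    refine h.symm.trans ?_
    exact (fderiv_apply_one_eq_deriv (f := incl ∘ γ)).trans (hγ' s).deriv
  have hd : ∀ s, HasDerivAt (fun r => lorentz (ambient X (γ r)) (ambient Y (γ r))) 0 s := fun s => by
    have hm := mdifferentiableAt_lorentz (hXd (γ s)) (hYd (γ s))
    have hm2 := (hγ s).mdifferentiableAt (by simp)
    have h := mfderiv_comp_apply s hm hm2 (1 : ℝ)
    rw [mfderiv_eq_fderiv, hvel] at h
    have h0 := h.trans (hzero (γ s))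
    have hdiff := (hm.comp s hm2).differentiableAt.hasDerivAt
    rw [← fderiv_apply_one_eq_deriv] at hdiff
    exact h0 ▸ hdiff
  exact is_const_of_deriv_eq_zero (fun s => (hd s).differentiableAt) (fun s => (hd s).deriv) s 0

/-! ### Great circles and quaternions -/

/-- The product of the quaternion with coordinates `z` by the imaginary quaternion with coordinates
`u`, on the left. -/
def quatMul (u : Fin 3 → ℝ) (z : E4) : E4 :=
  !₂[-u 0 * z 1 - u 1 * z 2 - u 2 * z 3,
    u 0 * z 0 + u 1 * z 3 - u 2 * z 2,
    -u 0 * z 3 + u 1 * z 0 + u 2 * z 1,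
    u 0 * z 2 - u 1 * z 1 + u 2 * z 0]

lemma inner_E4 (v w : E4) :
    inner ℝ v w = v 0 * w 0 + v 1 * w 1 + v 2 * w 2 + v 3 * w 3 := by
  simp [PiLp.inner_apply, Fin.sum_univ_four, mul_comm]

lemma quatMul_quatMul {u : Fin 3 → ℝ} (hu : u 0 ^ 2 + u 1 ^ 2 + u 2 ^ 2 = 1) (z : E4) :
    quatMul u (quatMul u z) = -z := by
  ext i
  fin_cases i <;> simp [quatMul]
  · linear_combination (-z 0) * hu
  · linear_combination (-z 1) * hu
  · linear_combination (-z 2) * hu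
  · linear_combination (-z 3) * hu

lemma inner_quatMul_self (u : Fin 3 → ℝ) (z : E4) : inner ℝ z (quatMul u z) = 0 := by
  rw [inner_E4]
  simp [quatMul]
  ring

lemma inner_quatMul_quatMul {u : Fin 3 → ℝ} (hu : u 0 ^ 2 + u 1 ^ 2 + u 2 ^ 2 = 1) (z : E4) :
    inner ℝ (quatMul u z) (quatMul u z) = inner ℝ z z := by
  rw [inner_E4, inner_E4]
  simp [quatMul]
  linear_combination (z 0 ^ 2 + z 1 ^ 2 + z 2 ^ 2 + z 3 ^ 2) * hu

lemma quatMul_comb (u : Fin 3 → ℝ) (a b : ℝ) (z w : E4) :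
    quatMul u (a • z + b • w) = a • quatMul u z + b • quatMul u w := by
  ext i
  fin_cases i <;> simp [quatMul] <;> ring

lemma inner_S3 (z : S3) : inner ℝ (z : E4) (z : E4) = 1 := by
  rw [real_inner_self_eq_norm_sq, norm_eq_of_mem_sphere z]
  norm_num

lemma greatCircle_mem {u : Fin 3 → ℝ} (hu : u 0 ^ 2 + u 1 ^ 2 + u 2 ^ 2 = 1) (z : S3) (s : ℝ) :
    Real.cos s • (z : E4) + Real.sin s • quatMul u z ∈ Metric.sphere (0 : E4) 1 := by
  rw [mem_sphere_zero_iff_norm, norm_eq_sqrt_real_inner, Real.sqrt_eq_one]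
  simp only [inner_add_left, inner_add_right, real_inner_smul_left, real_inner_smul_right,
    inner_quatMul_quatMul hu, inner_S3, inner_quatMul_self, real_inner_comm (z : E4) (quatMul u z)]
  linear_combination Real.sin_sq_add_cos_sq s

/-- The great circle through `z` which is the orbit of `z` under the left multiplications by
`exp (s u)`, where `u` is a unit imaginary quaternion. -/
def greatCircle {u : Fin 3 → ℝ} (hu : u 0 ^ 2 + u 1 ^ 2 + u 2 ^ 2 = 1) (z : S3) (s : ℝ) : S3 :=
  ⟨Real.cos s • (z : E4) + Real.sin s • quatMul u z, greatCircle_mem hu z s⟩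

lemma quatMul_greatCircle {u : Fin 3 → ℝ} (hu : u 0 ^ 2 + u 1 ^ 2 + u 2 ^ 2 = 1) (z : S3) (s : ℝ) :
    quatMul u (greatCircle hu z s) = Real.cos s • quatMul u z - Real.sin s • (z : E4) := by
  simp only [greatCircle, quatMul_comb, quatMul_quatMul hu, smul_neg, sub_eq_add_neg]

lemma greatCircle_zero {u : Fin 3 → ℝ} (hu : u 0 ^ 2 + u 1 ^ 2 + u 2 ^ 2 = 1) (z : S3) :
    greatCircle hu z 0 = z := Subtype.ext (by simp [greatCircle])

lemma greatCircle_two_pi {u : Fin 3 → ℝ} (hu : u 0 ^ 2 + u 1 ^ 2 + u 2 ^ 2 = 1) (z : S3) :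
    greatCircle hu z (2 * Real.pi) = z := Subtype.ext (by simp [greatCircle])

/-- The quaternion `w z⁻¹` has norm one, and its product with `z` is `w`. -/
lemma exists_quaternion (z w : S3) : ∃ (α : ℝ) (v : Fin 3 → ℝ),
    α ^ 2 + (v 0 ^ 2 + v 1 ^ 2 + v 2 ^ 2) = 1 ∧ (w : E4) = α • (z : E4) + quatMul v z := by
  have hz := inner_S3 z
  have hw := inner_S3 w
  rw [inner_E4] at hz hw
  generalize (z : E4) = z at hz ⊢
  generalize (w : E4) = w at hw ⊢
  refine ⟨w 0 * z 0 + w 1 * z 1 + w 2 * z 2 + w 3 * z 3,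
    ![-w 0 * z 1 + w 1 * z 0 - w 2 * z 3 + w 3 * z 2,
      -w 0 * z 2 + w 1 * z 3 + w 2 * z 0 - w 3 * z 1,
      -w 0 * z 3 - w 1 * z 2 + w 2 * z 1 + w 3 * z 0], ?_, ?_⟩
  · simp only [Matrix.cons_val]
    linear_combination (z 0 * z 0 + z 1 * z 1 + z 2 * z 2 + z 3 * z 3) * hw + hz
  · ext i
    fin_cases i <;> simp [quatMul]
    · linear_combination (-w 0) * hz
    · linear_combination (-w 1) * hz
    · linear_combination (-w 2) * hz
    · linear_combination (-w 3) * hz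

/-- Any two points of the sphere lie on one of the great circles `greatCircle`: the direction of the
circle is that of the imaginary part of the quaternion `w z⁻¹`. -/
lemma exists_greatCircle (z w : S3) : ∃ (u : Fin 3 → ℝ) (hu : u 0 ^ 2 + u 1 ^ 2 + u 2 ^ 2 = 1)
    (s : ℝ), w = greatCircle hu z s := by
  obtain ⟨α, v, h1, hdec⟩ := exists_quaternion z w
  obtain ⟨m, hm⟩ : ∃ m, m = √(v 0 ^ 2 + v 1 ^ 2 + v 2 ^ 2) := ⟨_, rfl⟩
  have hm2 : m ^ 2 = v 0 ^ 2 + v 1 ^ 2 + v 2 ^ 2 := hm ▸ Real.sq_sqrt (by positivity)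
  have hα : |α| ≤ 1 := by
    rw [← sq_le_one_iff_abs_le_one]
    linarith [sq_nonneg m]
  have hcos : Real.cos (Real.arccos α) = α := Real.cos_arccos (abs_le.1 hα).1 (abs_le.1 hα).2
  have hsin : Real.sin (Real.arccos α) = m := by
    rw [Real.sin_arccos, hm]
    congr 1
    linarith
  by_cases h0 : m = 0
  · -- `w = ± z`, and any direction will do
    rw [h0] at hm2
    have hv0 : v 0 = 0 := by nlinarith only [hm2, sq_nonneg (v 1), sq_nonneg (v 2)]
    have hv1 : v 1 = 0 := by nlinarith only [hm2, sq_nonneg (v 0), sq_nonneg (v 2)]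
    have hv2 : v 2 = 0 := by nlinarith only [hm2, sq_nonneg (v 1), sq_nonneg (v 0)]
    refine ⟨![1, 0, 0], by simp, Real.arccos α, Subtype.ext ?_⟩
    simp only [greatCircle, hcos, hsin, h0, zero_smul, add_zero]
    rw [hdec, add_eq_left]
    ext i
    fin_cases i <;> simp [quatMul, hv0, hv1, hv2]
  · refine ⟨fun i => v i / m, ?_, Real.arccos α, Subtype.ext ?_⟩
    · simp only
      field_simp
      exact hm2.symm
    · simp only [greatCircle, hcos, hsin]
      rw [hdec]
      congr 1
      ext i
      fin_cases i <;> simp [quatMul] <;> field_simp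

/-! ### The shape of a Killing field -/

/-- The velocity field of the left multiplications by `exp (s u)`, moving in time at speed `a`. -/
def helixField (a : ℝ) (u : Fin 3 → ℝ) : VectorField :=
  a • timeField +
    (u 0 • (planeRotationField (a := 0) (b := 1) (by decide) +
        planeRotationField (a := 2) (b := 3) (by decide)) +
      u 1 • (planeRotationField (a := 0) (b := 2) (by decide) +
        planeRotationField (a := 3) (b := 1) (by decide)) +
      u 2 • (planeRotationField (a := 0) (b := 3) (by decide) +
        planeRotationField (a := 1) (b := 2) (by decide)))

lemma ambient_helixField (a : ℝ) (u : Fin 3 → ℝ) (p : Universe) :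
    ambient (helixField a u) p = (a, quatMul u p.2) := by
  simp only [helixField, ambient_add, ambient_smul, ambient_timeField, ambient_planeRotationField]
  refine Prod.ext (by simp) (PiLp.ext fun i => ?_)
  fin_cases i <;> simp [rotVec, quatMul] <;> ring

lemma isKilling_helixField {R : ℝ → ℝ} {c : ℝ} (hR : ∀ t, R t = c) (a : ℝ) (u : Fin 3 → ℝ) :
    IsKilling R (helixField a u) := by
  have h : ∀ {a b : Fin 4} (hab : a ≠ b), planeRotationField hab ∈ killing R := fun hab =>
    isKilling_planeRotationField hR hab
  have ht : timeField ∈ killing R := isKilling_timeField hR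
  have key : helixField a u ∈ killing R := by
    refine add_mem (Submodule.smul_mem _ _ ht) (add_mem (add_mem ?_ ?_) ?_) <;>
      exact Submodule.smul_mem _ _ (add_mem (h _) (h _))
  exact key

/-- The product of a Killing field with the velocity of a helix is constant along the helix. -/
lemma lorentz_helix_const {R : ℝ → ℝ} {c : ℝ} (hR : ∀ t, R t = c) (hc : c ≠ 0) {X : VectorField}
    (hX : IsKilling R X) {u : Fin 3 → ℝ} (hu : u 0 ^ 2 + u 1 ^ 2 + u 2 ^ 2 = 1) (a t : ℝ) (z : S3)
    (s : ℝ) :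
    lorentz (ambient X (t + a * s, greatCircle hu z s)) (a, quatMul u (greatCircle hu z s)) =
      lorentz (ambient X (t, z)) (a, quatMul u z) := by
  have := finrank_E4
  have hσ : ContDiff ℝ ∞ (fun s => (greatCircle hu z s : E4)) :=
    (Real.contDiff_cos.smul contDiff_const).add (Real.contDiff_sin.smul contDiff_const)
  have hγ : ContMDiff 𝓘(ℝ, ℝ) modelM ∞
      (fun s => ((t + a * s, greatCircle hu z s) : Universe)) :=
    (contDiff_const.add (contDiff_const.mul contDiff_id)).contMDiff.prodMk
      (hσ.contMDiff.codRestrict_sphere (fun s => (greatCircle hu z s).2))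
  have h := lorentz_ambient_const hR hc hX (isKilling_helixField hR a u) (k := a * a - 1)
    (fun p => by rw [ambient_helixField, lorentz, inner_quatMul_quatMul hu, inner_S3]) hγ
    (fun s => by
      rw [ambient_helixField]
      have h1 : HasDerivAt (fun r => t + a * r) a s := by
        simpa using ((hasDerivAt_id s).const_mul a).const_add t
      have h2 := ((Real.hasDerivAt_cos s).smul_const (z : E4)).add
        ((Real.hasDerivAt_sin s).smul_const (quatMul u z))
      refine (h1.prodMk h2).congr_deriv (Prod.ext rfl ?_)
      simp only [quatMul_greatCircle, neg_smul]
      abel) s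
  simpa [ambient_helixField, greatCircle_zero] using h

/-- The time component of a Killing field does not depend on the time: it is the product with
`∂/∂x⁰`, whose integral curves are the lines `s ↦ (s, z)`. -/
lemma ambient_fst_time {R : ℝ → ℝ} {c : ℝ} (hR : ∀ t, R t = c) (hc : c ≠ 0) {X : VectorField}
    (hX : IsKilling R X) (t : ℝ) (z : S3) : (ambient X (t, z)).1 = (ambient X (0, z)).1 := by
  have hγ : ContMDiff 𝓘(ℝ, ℝ) modelM ∞ (fun s => ((s, z) : Universe)) :=
    contMDiff_id.prodMk contMDiff_const
  have h := lorentz_ambient_const hR hc hX (isKilling_timeField hR) (k := 1)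
    (fun p => by rw [ambient_timeField]; simp [lorentz]) hγ
    (fun s => by
      rw [ambient_timeField]
      exact (hasDerivAt_id s).prodMk (hasDerivAt_const s (z : E4))) t
  simpa [ambient_timeField, lorentz] using h

section
variable {R : ℝ → ℝ} {c : ℝ} {X : VectorField}

/-- The spatial part of a Killing field does not depend on the time. -/
lemma ambient_snd_time (hR : ∀ t, R t = c) (hc : c ≠ 0) (hX : IsKilling R X) (t : ℝ) (z : S3) :
    (ambient X (t, z)).2 = (ambient X (0, z)).2 := by
  have h : ∀ w : S3, inner ℝ (ambient X (t, z)).2 (w : E4) =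
      inner ℝ (ambient X (0, z)).2 (w : E4) := fun w => by
    obtain ⟨u, hu, s, rfl⟩ := exists_greatCircle z w
    have h1 := inner_ambient X (t, z)
    have h2 := inner_ambient X (0, z)
    -- after a full turn of the great circle, the helix is back over `z`, at the time `t`
    have h3 := lorentz_helix_const hR hc hX hu (t / (2 * Real.pi)) 0 z (2 * Real.pi)
    have ht : 0 + t / (2 * Real.pi) * (2 * Real.pi) = t := by field_simp; simp
    rw [ht, greatCircle_two_pi, lorentz, lorentz, ambient_fst_time hR hc hX t z] at h3
    rw [real_inner_comm] at h1 h2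
    simp only [greatCircle, inner_add_right, real_inner_smul_right] at h3 ⊢
    rw [h1, h2]
    linear_combination (-Real.sin s) * h3
  refine PiLp.ext fun i => ?_
  have hi := h ⟨EuclideanSpace.single i 1, by simp⟩
  simpa [EuclideanSpace.inner_single_right] using hi

lemma inner_ambient_antisymm (hR : ∀ t, R t = c) (hc : c ≠ 0) (hX : IsKilling R X) (t : ℝ)
    (z w : S3) :
    inner ℝ (ambient X (t, z)).2 (w : E4) + inner ℝ (ambient X (t, w)).2 (z : E4) = 0 := by
  obtain ⟨u, hu, s, hw⟩ := exists_greatCircle z w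
  have h1 := inner_ambient X (t, z)
  have h2 := inner_ambient X (t, w)
  have h3 := lorentz_helix_const hR hc hX hu 0 t z s
  rw [zero_mul, add_zero, ← hw, lorentz, lorentz] at h3
  have hwz : (w : E4) = Real.cos s • (z : E4) + Real.sin s • quatMul u z := by rw [hw]; rfl
  have hz : (z : E4) = Real.cos s • (w : E4) - Real.sin s • quatMul u w := by
    have hq : quatMul u w = Real.cos s • quatMul u z - Real.sin s • (z : E4) := by
      rw [hw]
      exact quatMul_greatCircle hu z s
    rw [hq, hwz]
    have h1 : (z : E4) = (Real.cos s ^ 2 + Real.sin s ^ 2) • (z : E4) := by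
      rw [Real.cos_sq_add_sin_sq, one_smul]
    refine h1.trans ?_
    module
  rw [real_inner_comm] at h1 h2
  simp only at h1 h2
  rw [congrArg (inner ℝ (ambient X (t, z)).2) hwz, congrArg (inner ℝ (ambient X (t, w)).2) hz]
  simp only [inner_add_right, inner_sub_right, real_inner_smul_right]
  rw [h1, h2]
  linear_combination Real.sin s * h3

lemma ambient_fst_const (hR : ∀ t, R t = c) (hc : c ≠ 0) (hX : IsKilling R X) (p q : Universe) :
    (ambient X p).1 = (ambient X q).1 := by
  obtain ⟨t, z⟩ := p
  obtain ⟨t', w⟩ := q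
  rw [ambient_fst_time hR hc hX t, ambient_fst_time hR hc hX t']
  obtain ⟨u, hu, s, rfl⟩ := exists_greatCircle z w
  have h1 := lorentz_helix_const hR hc hX hu 1 0 z s
  have h0 := lorentz_helix_const hR hc hX hu 0 0 z s
  simp only [lorentz] at h0 h1
  rw [ambient_fst_time hR hc hX, ambient_snd_time hR hc hX] at h0 h1
  linarith

end

lemma ambient_rotationField (b : Fin 6 → ℝ) (p : Universe) :
    ambient (∑ k, b k • rotationField k) p =
      (0, !₂[-b 0 * p.2.1 3 + b 3 * p.2.1 1 - b 5 * p.2.1 2,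
        -b 1 * p.2.1 3 - b 3 * p.2.1 0 + b 4 * p.2.1 2,
        -b 2 * p.2.1 3 - b 4 * p.2.1 1 + b 5 * p.2.1 0,
        b 0 * p.2.1 0 + b 1 * p.2.1 1 + b 2 * p.2.1 2]) := by
  simp only [Fin.sum_univ_six, ambient_add, ambient_smul, rotationField, Matrix.cons_val,
    ambient_planeRotationField]
  refine Prod.ext (by simp) (PiLp.ext fun i => ?_)
  fin_cases i <;> simp [rotVec] <;> ring

/-- Every Killing field is a combination of `∂/∂x⁰` and of the rotation fields. -/
lemma exists_eq_of_isKilling {R : ℝ → ℝ} {c : ℝ} (hR : ∀ t, R t = c) (hc : c ≠ 0)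
    {X : VectorField} (hX : IsKilling R X) :
    ∃ (a : ℝ) (b : Fin 6 → ℝ), X = a • timeField + ∑ k, b k • rotationField k := by
  set e : Fin 4 → S3 := fun i => ⟨EuclideanSpace.single i 1, by simp⟩ with he
  -- the matrix of the spatial part of `X`
  set A : Fin 4 → Fin 4 → ℝ := fun i j => (ambient X (0, e j)).2 i with hA
  have hcoord : ∀ (z : S3) (i : Fin 4), (ambient X (0, z)).2 i =
      -(A 0 i * z.1 0 + A 1 i * z.1 1 + A 2 i * z.1 2 + A 3 i * z.1 3) := fun z i => by
    have h := inner_ambient_antisymm hR hc hX 0 z (e i)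
    rw [inner_E4 (ambient X (0, e i)).2] at h
    simp only [he, EuclideanSpace.inner_single_right] at h
    simp only [hA, he]
    simp at h
    linarith
  have hskew : ∀ i j, A i j = -A j i := fun i j => by
    simp only [hA]
    rw [hcoord (e j) i]
    fin_cases j <;> simp [he, hA]
  refine ⟨(ambient X (0, e 0)).1, ![A 3 0, A 3 1, A 3 2, A 0 1, A 1 2, A 2 0],
    ambient_injective (funext fun p => ?_)⟩
  rw [ambient_add, ambient_smul, ambient_timeField, ambient_rotationField]
  refine Prod.ext ?_ (PiLp.ext fun i => ?_)
  · simpa using ambient_fst_const hR hc hX p _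
  · obtain ⟨t, z⟩ := p
    have h00 := hskew 0 0
    have h11 := hskew 1 1
    have h22 := hskew 2 2
    have h33 := hskew 3 3
    rw [ambient_snd_time hR hc hX, hcoord]
    fin_cases i <;> simp
    · rw [hskew 1 0]
      linear_combination (-z.1 0 / 2) * h00
    · rw [hskew 2 1]
      linear_combination (-z.1 1 / 2) * h11
    · rw [hskew 0 2]
      linear_combination (-z.1 2 / 2) * h22
    · rw [hskew 0 3, hskew 1 3, hskew 2 3]
      linear_combination (-z.1 3 / 2) * h33

lemma linearIndependent_fields :
    LinearIndependent ℝ (Fin.cons timeField rotationField : Fin 7 → VectorField) := by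
  rw [Fintype.linearIndependent_iff]
  intro g hg
  have hg' : g 0 • timeField + ∑ k : Fin 6, g k.succ • rotationField k = 0 := by
    rw [Fin.sum_univ_succ] at hg
    simpa using hg
  have h : ∀ i : Fin 4, ambient (g 0 • timeField + ∑ k : Fin 6, g k.succ • rotationField k)
      (0, ⟨EuclideanSpace.single i 1, by simp⟩) = 0 := fun i => by
    rw [hg']
    exact map_zero (mvfderiv modelM incl _)
  simp only [ambient_add, ambient_smul, ambient_timeField, ambient_rotationField] at h
  have h0 := h 0
  have h1 := h 1
  have h3 := h 3
  simp at h0 h1 h3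
  intro i
  fin_cases i <;> simp <;> tauto

/-! ### Causal character -/

lemma isSpacelike_of_fst_eq_zero {R : ℝ → ℝ} (hpos : ∀ t, 0 < R t) {X : VectorField}
    (h : ∀ p, (ambient X p).1 = 0) : IsSpacelike R X := by
  intro p hp
  rw [metric_eq_lorentz, lorentz, h, zero_mul, zero_sub, real_inner_self_eq_norm_sq]
  have h2 : (ambient X p).2 ≠ 0 := fun h2 => hp <|
    mvfderiv_incl_injective p <| (Prod.ext (h p) h2 : ambient X p = 0).trans
      (map_zero (mvfderiv modelM incl p)).symm
  rw [mul_neg, neg_lt_zero]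
  exact mul_pos (pow_pos (hpos p.1) 2) (pow_pos (norm_pos_iff.2 h2) 2)

lemma isTimelike_timeField {R : ℝ → ℝ} (hpos : ∀ t, 0 < R t) : IsTimelike R timeField := by
  intro p
  rw [metric_eq_lorentz, ambient_timeField]
  simpa [lorentz] using pow_pos (hpos p.1) 2

lemma rotationField_eq (k : Fin 6) :
    ∃ (a b : Fin 4) (hab : a ≠ b), rotationField k = planeRotationField hab := by
  fin_cases k <;> exact ⟨_, _, _, rfl⟩

end ClosedUniverse

end

open ClosedUniverse in
theorem theorem6p1 (R : ℝ → ℝ) (hpos : ∀ t, 0 < R t) (hR : ∀ t, HasDerivAt R 0 t) :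
    (∀ k, rotationField k ∈ killing R ∧ IsSpacelike R (rotationField k)) ∧
    (timeField ∈ killing R ∧ IsTimelike R timeField) ∧
    LinearIndependent ℝ rotationField ∧
    timeField ∉ Submodule.span ℝ (Set.range rotationField) ∧
    killing R = Submodule.span ℝ (insert timeField (Set.range rotationField)) ∧
    Module.finrank ℝ (killing R) = 7 := by
  have hc : ∀ t, R t = R 0 := fun t =>
    is_const_of_deriv_eq_zero (fun s => (hR s).differentiableAt) (fun s => (hR s).deriv) t 0
  have hc0 : R 0 ≠ 0 := (hpos 0).ne'
  have hrot : ∀ k, rotationField k ∈ killing R := fun k => by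
    obtain ⟨a, b, hab, h⟩ := rotationField_eq k
    rw [h]
    exact isKilling_planeRotationField hc hab
  have htime : timeField ∈ killing R := isKilling_timeField hc
  have hli := linearIndependent_finCons.1 linearIndependent_fields
  have hspan : killing R = Submodule.span ℝ (insert timeField (Set.range rotationField)) := by
    refine le_antisymm (fun X hX => ?_) (Submodule.span_le.2 ?_)
    · obtain ⟨a, b, rfl⟩ := exists_eq_of_isKilling hc hc0 hX
      refine add_mem (Submodule.smul_mem _ _ (Submodule.subset_span (Set.mem_insert _ _)))
        (Submodule.sum_mem _ fun k _ => Submodule.smul_mem _ _ (Submodule.subset_span ?_))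
      exact Set.mem_insert_of_mem _ (Set.mem_range_self k)
    · rintro _ (rfl | ⟨k, rfl⟩)
      exacts [htime, hrot k]
  refine ⟨fun k => ⟨hrot k, ?_⟩, ⟨htime, isTimelike_timeField hpos⟩, hli.1, hli.2, hspan, ?_⟩
  · obtain ⟨a, b, hab, h⟩ := rotationField_eq k
    rw [h]
    exact isSpacelike_of_fst_eq_zero hpos fun p => by rw [ambient_planeRotationField]
  · rw [hspan, ← Fin.range_cons]
    exact finrank_span_eq_card linearIndependent_fields
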